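/- Let $r$ and $d$ be positive integers with $r<d$. The random $d$-ary recursive tree $(\mathcal{T}_t)_{t\ge 0}$ is defined as follows: $\mathcal{T}_0$ consists of a single vertex (the root), and for each $t\ge 0$, given $\mathcal{T}_0,\dots,\mathcal{T}_t$, the tree $\mathcal{T}_{t+1}$ is obtained from $\mathcal{T}_t$ by picking a vertex without offspring (a leaf) of $\mathcal{T}_t$ uniformly at random and giving it exactly $d$ offspring. An $r$-ary subtree of $\mathcal{T}_t$ is a non-empty connected subtree of $\mathcal{T}_t$, not necessarily containing the root, in which every vertex has at most $r$ offspring. Let $S_t$ denote the number of vertices of a largest $r$-ary subtree of $\mathcal{T}_t$. Then there exists a constant $\delta<1$, depending only on $r$ and $d$, such that almost surely there is a (random) finite $N$ with $S_t < t^{\delta}$ for all $t\ge N$. -/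

import Mathlib

open MeasureTheory Filter

noncomputable section

namespace RecTree

/-- The vertices of the infinite rooted `d`-ary tree, in the usual (Ulam–Harris) coding: the root is
`[]`, the `d` offspring of `v` are `i :: v` for `i : Fin d`. -/
abbrev Vertex (d : ℕ) : Type := List (Fin d)

variable {d : ℕ}

/-- The vertices of the finite tree `T` that have no offspring in `T`. -/
def leaves (T : Finset (Vertex d)) : Finset (Vertex d) :=
  T.filter fun v => ∀ i : Fin d, i :: v ∉ T

/-- The tree obtained from `T` by giving the vertex `v` all its `d` offspring. -/
def grow (T : Finset (Vertex d)) (v : Vertex d) : Finset (Vertex d) :=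
  T ∪ Finset.univ.image fun i : Fin d => i :: v

/-- `T 0, T 1, T 2, …` is a random `d`-ary recursive tree on the probability space `(Ω, P)`:
it starts from the single vertex `[]`, and conditionally on the whole history up to time `t`, the
tree at time `t + 1` arises from the tree at time `t` by giving `d` offspring to a uniformly random
leaf of it. (Finite trees form a countable set, so the first field is measurability of each `T t`.)
-/
structure IsRandomRecursiveTree {Ω : Type*} [MeasurableSpace Ω] (P : Measure Ω)
    (T : ℕ → Ω → Finset (Vertex d)) : Prop where
  measurableSet_eq : ∀ (t : ℕ) (A : Finset (Vertex d)), MeasurableSet {ω | T t ω = A}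
  zero : ∀ᵐ ω ∂P, T 0 ω = {[]}
  succ : ∀ (t : ℕ) (h : ℕ → Finset (Vertex d)), ∀ v ∈ leaves (h t),
    P {ω | (∀ s ≤ t, T s ω = h s) ∧ T (t + 1) ω = grow (h t) v} =
      P {ω | ∀ s ≤ t, T s ω = h s} / (leaves (h t)).card

/-- `S` is an `r`-ary subtree of the infinite `d`-ary tree: it has a topmost vertex `ρ` (not
necessarily the root `[]`), contains with every other vertex the parent of that vertex (so it is
connected), and each of its vertices has at most `r` offspring in `S`. -/
def IsArySubtree (r : ℕ) (S : Finset (Vertex d)) : Prop :=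
  (∃ ρ ∈ S, ∀ v ∈ S, v ≠ ρ → ∃ (i : Fin d) (u : Vertex d), v = i :: u ∧ u ∈ S) ∧
    ∀ v ∈ S, (Finset.univ.filter fun i : Fin d => i :: v ∈ S).card ≤ r

open Classical in
/-- The number of vertices of a largest `r`-ary subtree of the finite tree `T`. -/
def maxArySubtree (r : ℕ) (T : Finset (Vertex d)) : ℕ :=
  (T.powerset.filter fun S => IsArySubtree r S).sup Finset.card

end RecTree

end

namespace RecTree

variable {d : ℕ}

/-! Since `r < d`, an `r`-ary subtree misses the whole subtree of some child at every vertex of the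
infinite tree (`IsArySubtree.avoidsChild`). Call a vertex balanced if the product of its children's
leaf counts is at least `ε` times the `d`-th power of its own. Each child then carries at least a
fraction `ε` of the leaves, so the missed child costs that fraction.

Fix `k`. The part of the subtree below `k` balanced splits has size at most `2 * (1 - ε) ^ k` times
the number of leaves. Every other vertex has fewer than `k` balanced proper ancestors, so it has
weight at least `2 ^ (-k)` in the potential, where each balanced ancestor contributes a factor
`1/2`. This gives the deterministic bound `card_le_of_avoidsChild`.

The potential has small mean. The leaf counts below the root form a Pólya urn, whose product moment
is explicit, so a split is balanced with probability bounded below and its mean weight is at most `1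
- ε / 2`. Given their sizes, the root's subtrees are again random recursive trees. The resulting
recursion bounds the mean by a constant times a power of the leaf count with exponent `β < 1`
(`exists_mean_potential_le`).

Markov's inequality and Borel–Cantelli at times `B ^ k`, with the same `k` counting balanced splits,
give geometric decay relative to `B ^ k`; monotonicity in time fills the gaps. -/

/-! ### Shapes and expectations under growth -/

/-- Finite rooted ordered trees in which every vertex has either no or exactly `d` offspring. -/
inductive Shape (d : ℕ) : Type
  | leaf : Shape d
  | node (c : Fin d → Shape d) : Shape d

/-- The number of vertices of a shape that have offspring. -/
def Shape.internal : Shape d → ℕ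
  | .leaf => 0
  | .node c => 1 + ∑ i, (c i).internal

/-- The number of leaves of a `d`-ary tree with `n` internal vertices. -/
noncomputable def numLeaves (d n : ℕ) : ℝ := 1 + ((d : ℝ) - 1) * n

/-- The sum of `f` over all shapes that arise from `τ` by giving `d` offspring to one leaf. -/
noncomputable def succSum : Shape d → (Shape d → ℝ) → ℝ
  | .leaf, f => f (.node fun _ => .leaf)
  | .node c, f => ∑ i, succSum (c i) fun τ => f (.node (Function.update c i τ))

/-- The expectation of `f` after one growth step from `τ`. -/
noncomputable def stepMean (f : Shape d → ℝ) (τ : Shape d) : ℝ :=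
  succSum τ f / numLeaves d τ.internal

/-- The expectation of `f` at the random recursive tree after `n` growth steps. -/
noncomputable def mean : ℕ → (Shape d → ℝ) → ℝ
  | 0, f => f .leaf
  | n + 1, f => mean n (stepMean f)

/-- The expectation, after one growth step, of a function of the family of the subtrees hanging
off the root. -/
noncomputable def forestStep (g : (Fin d → Shape d) → ℝ) (c : Fin d → Shape d) : ℝ :=
  (∑ i, succSum (c i) fun τ => g (Function.update c i τ)) /
    numLeaves d (1 + ∑ i, (c i).internal)

/-- The expectation of a function of the family of the subtrees hanging off the root, `n` growth
steps after the root received its offspring. -/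
noncomputable def forestMean : ℕ → ((Fin d → Shape d) → ℝ) → ℝ
  | 0, g => g fun _ => .leaf
  | n + 1, g => forestMean n (forestStep g)

lemma numLeaves_zero : numLeaves d 0 = 1 := by simp [numLeaves]

lemma one_le_numLeaves (hd : 1 ≤ d) (n : ℕ) : 1 ≤ numLeaves d n := by
  have : (1 : ℝ) ≤ d := by exact_mod_cast hd
  have : 0 ≤ ((d : ℝ) - 1) * n := mul_nonneg (by linarith) (by positivity)
  unfold numLeaves; linarith

lemma numLeaves_pos (hd : 1 ≤ d) (n : ℕ) : 0 < numLeaves d n :=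
  zero_lt_one.trans_le (one_le_numLeaves hd n)

lemma sum_numLeaves (u : Fin d → ℕ) : ∑ i, numLeaves d (u i) = numLeaves d (1 + ∑ i, u i) := by
  simp only [numLeaves, Finset.sum_add_distrib, ← Finset.mul_sum]
  push_cast
  simp
  ring

lemma succSum_add (τ : Shape d) (f g : Shape d → ℝ) :
    succSum τ (fun σ => f σ + g σ) = succSum τ f + succSum τ g := by
  induction τ generalizing f g with
  | leaf => rfl
  | node c ih => simp only [succSum, ih, Finset.sum_add_distrib]

lemma succSum_const_mul (τ : Shape d) (a : ℝ) (f : Shape d → ℝ) :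
    succSum τ (fun σ => a * f σ) = a * succSum τ f := by
  induction τ generalizing f with
  | leaf => rfl
  | node c ih => simp only [succSum, ih, Finset.mul_sum]

lemma internal_node_update (c : Fin d → Shape d) (i : Fin d) (τ : Shape d)
    (h : τ.internal = (c i).internal + 1) :
    (Shape.node (Function.update c i τ)).internal = (Shape.node c).internal + 1 := by
  simp only [Shape.internal]
  rw [← Finset.add_sum_erase _ _ (Finset.mem_univ i),
    ← Finset.add_sum_erase _ (fun i => (c i).internal) (Finset.mem_univ i)]
  rw [Finset.sum_congr rfl fun j hj => by rw [Function.update_of_ne (Finset.ne_of_mem_erase hj)]]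
  simp [h]
  ring

lemma succSum_mono (τ : Shape d) {f g : Shape d → ℝ}
    (h : ∀ σ : Shape d, σ.internal = τ.internal + 1 → f σ ≤ g σ) :
    succSum τ f ≤ succSum τ g := by
  induction τ generalizing f g with
  | leaf => exact h _ (by simp [Shape.internal])
  | node c ih =>
    exact Finset.sum_le_sum fun i _ => ih i fun σ hσ => h _ (internal_node_update c i σ hσ)

lemma succSum_congr (τ : Shape d) {f g : Shape d → ℝ}
    (h : ∀ σ : Shape d, σ.internal = τ.internal + 1 → f σ = g σ) :
    succSum τ f = succSum τ g :=
  (succSum_mono τ fun σ hσ => (h σ hσ).le).antisymm (succSum_mono τ fun σ hσ => (h σ hσ).ge)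

lemma succSum_one (τ : Shape d) : succSum τ (fun _ => 1) = numLeaves d τ.internal := by
  induction τ with
  | leaf => simp [succSum, Shape.internal, numLeaves_zero]
  | node c ih => simp only [succSum, ih, Shape.internal, sum_numLeaves]

lemma succSum_internal_mul (τ : Shape d) (h : ℕ → ℝ) (f : Shape d → ℝ) :
    succSum τ (fun σ => h σ.internal * f σ) = h (τ.internal + 1) * succSum τ f := by
  rw [← succSum_const_mul]
  exact succSum_congr τ fun σ hσ => by rw [hσ]

lemma forestStep_mono (hd : 1 ≤ d) {f g : (Fin d → Shape d) → ℝ} (c : Fin d → Shape d)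
    (h : ∀ b : Fin d → Shape d, ∑ i, (b i).internal = ∑ i, (c i).internal + 1 → f b ≤ g b) :
    forestStep f c ≤ forestStep g c := by
  refine div_le_div_of_nonneg_right ?_ (numLeaves_pos hd _).le
  refine Finset.sum_le_sum fun i _ => succSum_mono _ fun σ hσ => h _ ?_
  have := internal_node_update c i σ hσ
  simp only [Shape.internal] at this
  omega

lemma forestMean_mono (hd : 1 ≤ d) {n : ℕ} {f g : (Fin d → Shape d) → ℝ}
    (h : ∀ c : Fin d → Shape d, ∑ i, (c i).internal = n → f c ≤ g c) :
    forestMean n f ≤ forestMean n g := by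
  induction n generalizing f g with
  | zero => exact h _ (by simp [Shape.internal])
  | succ n ih => exact ih fun c hc => forestStep_mono hd c fun b hb => h b (by rw [hb, hc])

lemma forestMean_congr (hd : 1 ≤ d) {n : ℕ} {f g : (Fin d → Shape d) → ℝ}
    (h : ∀ c : Fin d → Shape d, ∑ i, (c i).internal = n → f c = g c) :
    forestMean n f = forestMean n g :=
  (forestMean_mono hd fun c hc => (h c hc).le).antisymm
    (forestMean_mono hd fun c hc => (h c hc).ge)

lemma forestMean_add (n : ℕ) (f g : (Fin d → Shape d) → ℝ) :
    forestMean n (fun c => f c + g c) = forestMean n f + forestMean n g := by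
  induction n generalizing f g with
  | zero => rfl
  | succ n ih =>
    simp only [forestMean, ← ih]
    congr 1
    funext c
    simp only [forestStep, succSum_add, Finset.sum_add_distrib, add_div]

lemma forestMean_const_mul (n : ℕ) (a : ℝ) (f : (Fin d → Shape d) → ℝ) :
    forestMean n (fun c => a * f c) = a * forestMean n f := by
  induction n generalizing f with
  | zero => rfl
  | succ n ih =>
    simp only [forestMean, ← ih]
    congr 1
    funext c
    simp only [forestStep, succSum_const_mul, ← Finset.mul_sum, mul_div_assoc]

lemma forestMean_sum {ι : Type*} (s : Finset ι) (n : ℕ) (f : ι → (Fin d → Shape d) → ℝ) :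
    forestMean n (fun c => ∑ j ∈ s, f j c) = ∑ j ∈ s, forestMean n (f j) := by
  classical
  induction s using Finset.induction_on with
  | empty => simpa using forestMean_const_mul n 0 fun _ : Fin d → Shape d => 0
  | insert a s ha ih => simp only [Finset.sum_insert ha, forestMean_add, ih]

lemma forestMean_const (hd : 1 ≤ d) (n : ℕ) (a : ℝ) :
    forestMean n (fun _ : Fin d → Shape d => a) = a := by
  induction n with
  | zero => rfl
  | succ n ih =>
    rw [forestMean]
    convert ih using 2
    funext c
    have h : ∀ τ : Shape d, succSum τ (fun _ => a) = a * numLeaves d τ.internal := fun τ => by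
      simpa [succSum_one] using succSum_const_mul τ a fun _ => 1
    simp only [forestStep, h, ← Finset.mul_sum, sum_numLeaves]
    rw [mul_div_assoc, div_self (numLeaves_pos hd _).ne', mul_one]

/-- `mean` unfolds at the last growth step; this decomposes at the first one, which always splits
the root. -/
lemma mean_succ (n : ℕ) (f : Shape d → ℝ) :
    mean (n + 1) f = forestMean n fun c => f (.node c) := by
  induction n generalizing f with
  | zero => simp [mean, forestMean, stepMean, succSum, Shape.internal, numLeaves_zero]
  | succ n ih =>
    rw [mean, ih, forestMean]
    rfl

/-! ### The split at the root: conditional laws and the Pólya urn -/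

/-- Given the numbers of internal vertices of the subtrees hanging off the root, each of these
subtrees is distributed as a random recursive tree. -/
lemma forestMean_mul_apply (hd : 1 ≤ d) (n : ℕ) (w : (Fin d → ℕ) → ℝ) (f : Shape d → ℝ)
    (i : Fin d) :
    forestMean n (fun c => w (fun j => (c j).internal) * f (c i)) =
      forestMean n (fun c => w (fun j => (c j).internal) * mean (c i).internal f) := by
  induction n generalizing w f with
  | zero => rfl
  | succ n ih =>
    -- The probability that the next step falls in subtree `j`, times the value of `w` after it. It
    -- again depends on sizes only, so the induction hypothesis applies to it.
    let W : Fin d → (Fin d → ℕ) → ℝ := fun j u =>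
      numLeaves d (u j) * w (Function.update u j (u j + 1)) / numLeaves d (1 + ∑ i, u i)
    have key : ∀ (g : Shape d → ℝ) (c : Fin d → Shape d),
        forestStep (fun c => w (fun j => (c j).internal) * g (c i)) c =
          ∑ j, W j (fun k => (c k).internal) * (if j = i then stepMean g (c i) else g (c i)) := by
      intro g c
      simp only [forestStep, Finset.sum_div]
      refine Finset.sum_congr rfl fun j _ => ?_
      have hu : ∀ σ : Shape d, (fun k => (Function.update c j σ k).internal) =
          Function.update (fun k => (c k).internal) j σ.internal := fun σ => by
        funext k
        by_cases hk : k = j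
        · subst hk; simp
        · simp [hk]
      simp only [hu]
      have h1 := succSum_internal_mul (c j)
        (fun m => w (Function.update (fun k => (c k).internal) j m))
        (fun σ => g (Function.update c j σ i))
      have hpos := (numLeaves_pos hd (c i).internal).ne'
      have hpos' := (numLeaves_pos hd (1 + ∑ i, (c i).internal)).ne'
      rw [h1]
      split_ifs with hji
      · subst hji
        simp only [Function.update_self, stepMean, W]
        field_simp
      · have : succSum (c j) (fun σ => g (Function.update c j σ i)) =
            g (c i) * numLeaves d (c j).internal := by
          simp only [Function.update_of_ne (Ne.symm hji)]
          simpa [succSum_one] using succSum_const_mul (c j) (g (c i)) fun _ => 1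
        rw [this]
        simp only [W]
        field_simp
    simp only [forestMean]
    have key' : ∀ c : Fin d → Shape d,
        forestStep (fun c => w (fun j => (c j).internal) * mean (c i).internal f) c =
          ∑ j, W j (fun k => (c k).internal) *
            mean (c i).internal (if j = i then stepMean f else f) := by
      intro c
      rw [key (fun σ => mean σ.internal f) c]
      refine Finset.sum_congr rfl fun j _ => ?_
      split_ifs with hji
      · congr 1
        have := succSum_internal_mul (c i) (fun m => mean m f) fun _ => 1
        simp only [mul_one, succSum_one] at this
        rw [stepMean, this, mul_div_cancel_right₀ _ (numLeaves_pos hd _).ne']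
        rfl
      · rfl
    rw [show forestStep (fun c => w (fun j => (c j).internal) * f (c i)) = fun c =>
        ∑ j, W j (fun k => (c k).internal) * (if j = i then stepMean f else f) (c i) from
        funext fun c => by
          rw [key f c]
          exact Finset.sum_congr rfl fun j _ => by split_ifs <;> rfl,
      show forestStep (fun c => w (fun j => (c j).internal) * mean (c i).internal f) = fun c =>
        ∑ j, W j (fun k => (c k).internal) *
            mean (c i).internal (if j = i then stepMean f else f) from funext key',
      forestMean_sum, forestMean_sum]
    exact Finset.sum_congr rfl fun j _ => ih (W j) _

lemma prod_update_internal (c : Fin d → Shape d) (j : Fin d) (σ : Shape d) :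
    ∏ i, numLeaves d (Function.update c j σ i).internal =
      numLeaves d σ.internal * ∏ i ∈ Finset.univ.erase j, numLeaves d (c i).internal := by
  rw [← Finset.mul_prod_erase _ _ (Finset.mem_univ j), Function.update_self]
  congr 1
  exact Finset.prod_congr rfl fun k hk => by
    rw [Function.update_of_ne (Finset.ne_of_mem_erase hk)]

/-- A step in subtree `j` has probability proportional to its leaf count and replaces that factor by
its successor. Summing over `j`, the mean product is multiplied by `(L + d * (d - 1)) / L`, with `L`
the total leaf count; these ratios telescope. -/
lemma forestMean_prod_numLeaves (hd : 1 ≤ d) (n : ℕ) :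
    forestMean n (fun c : Fin d → Shape d => ∏ i, numLeaves d (c i).internal) *
      ∏ j ∈ Finset.range d, numLeaves d (j + 1) =
      ∏ j ∈ Finset.range d, numLeaves d (n + 1 + j) := by
  induction n with
  | zero =>
    simp [forestMean, Shape.internal, numLeaves_zero]
    exact Finset.prod_congr rfl fun j _ => by rw [add_comm]
  | succ n ih =>
    have hn := (numLeaves_pos hd (n + 1)).ne'
    have step : forestMean (n + 1) (fun c : Fin d → Shape d =>
        ∏ i, numLeaves d (c i).internal) = numLeaves d (n + 1 + d) / numLeaves d (n + 1) *
          forestMean n (fun c : Fin d → Shape d => ∏ i, numLeaves d (c i).internal) := by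
      rw [← forestMean_const_mul, forestMean]
      refine forestMean_congr hd fun c hc => ?_
      rw [forestStep, hc, add_comm 1 n, div_mul_eq_mul_div]
      congr 1
      have : ∀ j, succSum (c j) (fun τ => ∏ i, numLeaves d (Function.update c j τ i).internal) =
          numLeaves d ((c j).internal + 1) * ∏ i, numLeaves d (c i).internal := by
        intro j
        simp only [prod_update_internal]
        have := succSum_internal_mul (c j) (numLeaves d)
          fun _ => ∏ i ∈ Finset.univ.erase j, numLeaves d (c i).internal
        rw [this, ← Finset.mul_prod_erase _ (fun i => numLeaves d (c i).internal)
          (Finset.mem_univ j)]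
        congr 1
        have := succSum_const_mul (c j)
          (∏ i ∈ Finset.univ.erase j, numLeaves d (c i).internal) fun _ => 1
        rw [succSum_one] at this
        simp only [mul_one] at this
        rw [this, mul_comm]
      simp only [this]
      rw [← Finset.sum_mul, sum_numLeaves, Finset.sum_add_distrib, hc]
      congr 2
      simp
      ring
    rw [step, mul_assoc, ih, div_mul_eq_mul_div, div_eq_iff hn]
    have h1 := Finset.prod_range_succ (fun j => numLeaves d (n + 1 + j)) d
    have h2 := Finset.prod_range_succ' (fun j => numLeaves d (n + 1 + j)) d
    rw [h1] at h2
    rw [mul_comm, h2]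
    simp only [add_zero]
    congr 1
    exact Finset.prod_congr rfl fun j _ => by congr 1; ring

/-! ### Balanced splits and the mean of the potential -/

open Classical in
/-- The weight of a vertex whose children carry `u i` internal vertices: `1/2` if the split is
balanced to the extent measured by `ε`, and `1` otherwise. -/
noncomputable def splitWeight (ε : ℝ) (u : Fin d → ℕ) : ℝ :=
  if ε * numLeaves d (1 + ∑ i, u i) ^ d ≤ ∏ i, numLeaves d (u i) then 1 / 2 else 1

/-- The sum over all vertices of the product of the split weights of their proper ancestors. -/
noncomputable def potential (ε : ℝ) : Shape d → ℝ
  | .leaf => 1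
  | .node c => 1 + splitWeight ε (fun i => (c i).internal) * ∑ i, potential ε (c i)

lemma splitWeight_pos (ε : ℝ) (u : Fin d → ℕ) : 0 < splitWeight ε u := by
  unfold splitWeight; split_ifs <;> norm_num

lemma potential_pos (ε : ℝ) (τ : Shape d) : 0 < potential ε τ := by
  induction τ with
  | leaf => exact one_pos
  | node c ih =>
    have := mul_nonneg (splitWeight_pos ε fun i => (c i).internal).le
      (Finset.sum_nonneg fun i (_ : i ∈ Finset.univ) => (ih i).le)
    rw [potential]; linarith

/-- A large product forces every factor to be large: in a balanced split each child has at least a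
fraction `ε` of the leaves. -/
lemma prod_numLeaves_le (hd : 1 ≤ d) (u : Fin d → ℕ) (i : Fin d) :
    ∏ j, numLeaves d (u j) ≤ numLeaves d (u i) * numLeaves d (1 + ∑ j, u j) ^ (d - 1) := by
  rw [← Finset.mul_prod_erase _ _ (Finset.mem_univ i)]
  refine mul_le_mul_of_nonneg_left ?_ (numLeaves_pos hd _).le
  have hc : (Finset.univ.erase i).card = d - 1 := by simp
  rw [← hc]
  rw [← Finset.prod_const]
  refine Finset.prod_le_prod (fun j _ => (numLeaves_pos hd _).le) fun j _ => ?_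
  rw [← sum_numLeaves]
  exact Finset.single_le_sum (f := fun j => numLeaves d (u j))
    (fun j _ => (numLeaves_pos hd _).le) (Finset.mem_univ j)

/-- The expected weight of the split at the root is bounded away from `1`. -/
lemma forestMean_splitWeight_le (hd : 1 ≤ d) {ε : ℝ}
    (hε0 : 0 ≤ ε) (hε : ε * (2 * ∏ j ∈ Finset.range d, numLeaves d (j + 1)) ≤ 1) (n : ℕ) :
    forestMean n (fun c : Fin d → Shape d => splitWeight ε fun i => (c i).internal) ≤
      1 - ε / 2 := by
  set Q := ∏ j ∈ Finset.range d, numLeaves d (j + 1) with hQ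
  have hQ0 : 0 < Q := Finset.prod_pos fun j _ => numLeaves_pos hd _
  set L := numLeaves d (n + 1) with hL
  have hL0 : 0 < L := numLeaves_pos hd _
  have hpow : L ^ d ≤ ∏ j ∈ Finset.range d, numLeaves d (n + 1 + j) := by
    have : L ^ d = ∏ _j ∈ Finset.range d, L := by simp
    rw [this]
    refine Finset.prod_le_prod (fun _ _ => hL0.le) fun j _ => ?_
    have h1 : (1 : ℝ) ≤ d := by exact_mod_cast hd
    simp only [hL, numLeaves]
    have h2 : ((n + 1 : ℕ) : ℝ) ≤ (n + 1 + j : ℕ) := by exact_mod_cast Nat.le_add_right _ _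
    have := mul_le_mul_of_nonneg_left h2 (sub_nonneg.2 h1)
    linarith
  have hmean := forestMean_prod_numLeaves hd n
  set M := forestMean n (fun c : Fin d → Shape d => ∏ i, numLeaves d (c i).internal) with hM
  have hMle : 2 * ε ≤ M / L ^ d := by
    rw [le_div_iff₀ (by positivity)]
    have h1 : L ^ d ≤ M * Q := hmean ▸ hpow
    have h2 : 2 * ε ≤ 1 / Q := by rw [le_div_iff₀ hQ0]; linarith
    calc 2 * ε * L ^ d ≤ 1 / Q * (M * Q) := by gcongr
      _ = M := by field_simp
  -- Let `X` be the product divided by `L ^ d`, so `X ≤ 1`. Pointwise the weight is at most `1 + ε /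
  -- 2 - X / 2`, whether `X ≥ ε` or not; and `X` has mean at least `2 * ε`.
  have hle : forestMean n (fun c : Fin d → Shape d => splitWeight ε fun i => (c i).internal) ≤
      forestMean n (fun c : Fin d → Shape d =>
        (1 + ε / 2) + -(1 / (2 * L ^ d)) * ∏ i, numLeaves d (c i).internal) := by
    refine forestMean_mono hd fun c hc => ?_
    have hX : ∏ i, numLeaves d (c i).internal ≤ L ^ d := by
      have : L ^ d = ∏ _j : Fin d, L := by simp
      rw [this]
      refine Finset.prod_le_prod (fun j _ => (numLeaves_pos hd _).le) fun j _ => ?_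
      rw [hL, ← hc, add_comm, ← sum_numLeaves]
      exact Finset.single_le_sum (f := fun j => numLeaves d (c j).internal)
        (fun j _ => (numLeaves_pos hd _).le) (Finset.mem_univ j)
    have hLd : 0 < L ^ d := by positivity
    have e : -(1 / (2 * L ^ d)) * ∏ i, numLeaves d (c i).internal =
      -((∏ i, numLeaves d (c i).internal) / L ^ d) / 2 := by field_simp
    rw [e, splitWeight, hc, add_comm 1 n]
    split_ifs with h
    · have : (∏ i, numLeaves d (c i).internal) / L ^ d ≤ 1 := (div_le_one hLd).2 hX
      linarith
    · have : (∏ i, numLeaves d (c i).internal) / L ^ d < ε := by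
        rw [div_lt_iff₀ hLd]; exact not_le.1 h
      linarith
  rw [forestMean_add, forestMean_const hd, forestMean_const_mul] at hle
  refine hle.trans ?_
  have : -(1 / (2 * L ^ d)) * M = - (M / L ^ d) / 2 := by field_simp
  rw [this]
  linarith

/-- Concavity of the power: each term lies below the tangent at the equal split (Bernoulli), and the
linear parts cancel in the sum. -/
lemma sum_rpow_le_of_sum_eq (hd : 1 ≤ d) {x : Fin d → ℝ} (hx : ∀ i, 0 ≤ x i) {L : ℝ} (hL : 0 < L)
    (hsum : ∑ i, x i = L) {β : ℝ} (h0 : 0 ≤ β) (h1 : β ≤ 1) :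
    ∑ i, x i ^ β ≤ d * (1 / d) ^ β * L ^ β := by
  have hd0 : (0 : ℝ) < d := by exact_mod_cast hd
  have hle : ∀ i, x i ^ β ≤ (1 / d) ^ β * L ^ β * (1 + β * (d * x i / L - 1)) := by
    intro i
    have hy : 0 ≤ d * x i / L := by have := hx i; positivity
    have hb := rpow_one_add_le_one_add_mul_self (s := d * x i / L - 1) (by linarith) h0 h1
    calc x i ^ β = (1 / d * L * (1 + (d * x i / L - 1))) ^ β := by congr 1; field_simp; ring
      _ = (1 / d) ^ β * L ^ β * (1 + (d * x i / L - 1)) ^ β := by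
        rw [Real.mul_rpow (by positivity) (by linarith), Real.mul_rpow (by positivity) hL.le]
      _ ≤ _ := by gcongr
  refine (Finset.sum_le_sum fun i _ => hle i).trans_eq ?_
  rw [← Finset.mul_sum, Finset.sum_add_distrib, ← Finset.mul_sum, Finset.sum_sub_distrib,
    ← Finset.sum_div, ← Finset.mul_sum, hsum]
  simp only [Finset.sum_const, Finset.card_univ, Fintype.card_fin, nsmul_eq_mul]
  field_simp
  ring

/-- The expected potential grows at most like a power of the number of leaves with exponent
less than `1`. -/
lemma exists_mean_potential_le (hd : 1 ≤ d) :
    ∃ ε : ℝ, 0 < ε ∧ ε < 1 ∧ ∃ β : ℝ, 0 < β ∧ β < 1 ∧ ∃ C : ℝ, 0 < C ∧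
      ∀ n, mean n (potential (d := d) ε) ≤ C * numLeaves d n ^ β := by
  set Q := ∏ j ∈ Finset.range d, numLeaves d (j + 1) with hQ
  have hQ1 : 1 ≤ Q := by
    rw [hQ, ← Finset.prod_const_one (s := Finset.range d)]
    exact Finset.prod_le_prod (fun _ _ => zero_le_one) fun j _ => one_le_numLeaves hd _
  have hd0 : (0 : ℝ) < d := by exact_mod_cast hd
  obtain ⟨ε, hε0, hε1, hε⟩ : ∃ ε : ℝ, 0 < ε ∧ ε < 1 ∧ ε * (2 * Q) ≤ 1 :=
    ⟨1 / (2 * Q), by positivity, by rw [div_lt_one (by positivity)]; linarith,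
      by field_simp; rfl⟩
  -- The loss `d ^ (1 - β)` from concavity tends to `1` as `β → 1`, so the gain `1 - ε / 2` beats
  -- it: `(1 + ε / 2) * (1 - ε / 2) < 1`.
  obtain ⟨β, hβ0, hβ1, hβ⟩ : ∃ β : ℝ, 0 < β ∧ β < 1 ∧ d * (1 / d : ℝ) ^ β < 1 + ε / 2 := by
    have hc : Tendsto (fun β : ℝ => d * (1 / d : ℝ) ^ β) (nhdsWithin 1 (Set.Iio 1)) (nhds 1) := by
      have : ContinuousAt (fun β : ℝ => d * (1 / d : ℝ) ^ β) 1 :=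
        continuousAt_const.mul (Real.continuousAt_const_rpow (by positivity))
      have h := this.tendsto
      rw [show (d : ℝ) * (1 / d : ℝ) ^ (1 : ℝ) = 1 by rw [Real.rpow_one]; field_simp] at h
      exact h.mono_left nhdsWithin_le_nhds
    have h1 := hc.eventually (gt_mem_nhds (show (1 : ℝ) < 1 + ε / 2 by linarith))
    have h2 : ∀ᶠ β : ℝ in nhdsWithin 1 (Set.Iio 1), 0 < β :=
      nhdsWithin_le_nhds (lt_mem_nhds one_pos)
    obtain ⟨β, ⟨h1, h2⟩, h3⟩ := ((h1.and h2).and self_mem_nhdsWithin).exists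
    exact ⟨β, h2, h3, h1⟩
  refine ⟨ε, hε0, hε1, β, hβ0, hβ1, 4 / ε ^ 2, by positivity, fun n => ?_⟩
  -- With this value the surplus `C * ε ^ 2 / 4 * L ^ β` equals `L ^ β ≥ 1` and pays for the root's
  -- own unit.
  set C := 4 / ε ^ 2 with hC
  have hC0 : 0 < C := by positivity
  induction n using Nat.strong_induction_on with
  | _ n ih =>
  cases n with
  | zero =>
    simp only [mean, potential, numLeaves_zero, Real.one_rpow, mul_one, hC]
    rw [le_div_iff₀ (by positivity)]
    nlinarith
  | succ n =>
    set L := numLeaves d (n + 1) with hL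
    have hL1 : 1 ≤ L := one_le_numLeaves hd _
    have hL0 : 0 < L := by linarith
    rw [mean_succ]
    simp only [potential]
    rw [forestMean_add, forestMean_const hd]
    simp only [Finset.mul_sum]
    rw [forestMean_sum]
    simp only [forestMean_mul_apply hd n (splitWeight ε) (potential (d := d) ε)]
    rw [← forestMean_sum]
    have hle : forestMean n (fun c : Fin d → Shape d =>
        ∑ j, splitWeight ε (fun j => (c j).internal) * mean (c j).internal (potential (d := d) ε)) ≤
        forestMean n (fun c : Fin d → Shape d =>
          C * (d * (1 / d) ^ β * L ^ β) * splitWeight ε (fun j => (c j).internal)) := by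
      refine forestMean_mono hd fun c hc => ?_
      rw [← Finset.mul_sum, mul_comm]
      refine mul_le_mul_of_nonneg_right ?_ (splitWeight_pos _ _).le
      calc ∑ j, mean (c j).internal (potential (d := d) ε)
          ≤ ∑ j, C * numLeaves d (c j).internal ^ β := by
            refine Finset.sum_le_sum fun j _ => ih _ ?_
            have := Finset.single_le_sum (f := fun j => (c j).internal)
              (fun j _ => Nat.zero_le _) (Finset.mem_univ j)
            omega
        _ ≤ _ := by
            rw [← Finset.mul_sum]
            refine mul_le_mul_of_nonneg_left ?_ hC0.le
            refine sum_rpow_le_of_sum_eq hd (fun i => (numLeaves_pos hd _).le) hL0 ?_ hβ0.le hβ1.le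
            rw [sum_numLeaves, hc, hL, add_comm]
    rw [forestMean_const_mul] at hle
    have hw := forestMean_splitWeight_le hd hε0.le hε n
    have hLβ : 1 ≤ L ^ β := Real.one_le_rpow hL1 hβ0.le
    calc _ ≤ 1 + C * (d * (1 / d) ^ β * L ^ β) * (1 - ε / 2) := by
          gcongr; exact hle.trans (by gcongr)
      _ ≤ 1 + C * ((1 + ε / 2) * L ^ β) * (1 - ε / 2) := by
          gcongr
          linarith
      _ = 1 + (C * L ^ β - (C * ε ^ 2 / 4) * L ^ β) := by ring
      _ = C * L ^ β - (L ^ β - 1) := by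
          rw [show C * ε ^ 2 / 4 = 1 by rw [hC]; field_simp]; ring
      _ ≤ C * L ^ β := by linarith

/-! ### Shapes as finite sets of vertices -/

/-- The tree whose root has the offspring `[i]`, with the tree `B i` hanging off `[i]`. -/
def joinTrees (B : Fin d → Finset (Vertex d)) : Finset (Vertex d) :=
  insert [] (Finset.univ.biUnion fun i => (B i).image (· ++ [i]))

/-- The set of vertices of a shape. -/
def Shape.toFinset : Shape d → Finset (Vertex d)
  | .leaf => {[]}
  | .node c => joinTrees fun i => (c i).toFinset

lemma nil_mem_joinTrees (B : Fin d → Finset (Vertex d)) : [] ∈ joinTrees B :=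
  Finset.mem_insert_self _ _

lemma append_mem_joinTrees {B : Fin d → Finset (Vertex d)} {v : Vertex d} {i : Fin d} :
    v ++ [i] ∈ joinTrees B ↔ v ∈ B i := by
  simp [joinTrees]

lemma cons_mem_joinTrees {B : Fin d → Finset (Vertex d)} {v : Vertex d} {i j : Fin d} :
    j :: (v ++ [i]) ∈ joinTrees B ↔ j :: v ∈ B i := by
  rw [← List.cons_append, append_mem_joinTrees]

lemma nil_mem_toFinset (τ : Shape d) : [] ∈ τ.toFinset := by
  cases τ with
  | leaf => simp [Shape.toFinset]
  | node c => exact nil_mem_joinTrees _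

lemma leaves_joinTrees (hd : 1 ≤ d) {B : Fin d → Finset (Vertex d)} (hB : ∀ i, [] ∈ B i) :
    leaves (joinTrees B) = Finset.univ.biUnion fun i => (leaves (B i)).image (· ++ [i]) := by
  ext v
  rcases List.eq_nil_or_concat v with rfl | ⟨u, j, rfl⟩
  · have : [(⟨0, hd⟩ : Fin d)] ∈ joinTrees B :=
      append_mem_joinTrees (v := []).2 (hB _)
    simp only [leaves, Finset.mem_filter]
    refine iff_of_false (fun h => h.2 _ this) (by simp)
  · simp [leaves, append_mem_joinTrees, cons_mem_joinTrees]

lemma grow_joinTrees (B : Fin d → Finset (Vertex d)) (v : Vertex d) (i : Fin d) :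
    grow (joinTrees B) (v ++ [i]) = joinTrees (Function.update B i (grow (B i) v)) := by
  ext u
  rcases List.eq_nil_or_concat u with rfl | ⟨u, j, rfl⟩
  · simp [grow, nil_mem_joinTrees]
  · simp only [grow, Finset.mem_union, append_mem_joinTrees, Finset.mem_image, Finset.mem_univ,
      true_and, List.concat_eq_append]
    by_cases hj : j = i
    · subst hj
      simp only [Function.update_self, Finset.mem_union, Finset.mem_image, Finset.mem_univ,
        true_and, ← List.cons_append, List.append_left_inj]
    · simp only [Function.update_of_ne hj, or_iff_left_iff_imp]
      rintro ⟨a, ha⟩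
      rw [← List.cons_append] at ha
      have := (List.append_inj' ha rfl).2
      simp_all

/-- Growth of shapes corresponds to growth of finite trees. -/
lemma succSum_toFinset (hd : 1 ≤ d) (τ : Shape d) (f : Finset (Vertex d) → ℝ) :
    succSum τ (fun σ => f σ.toFinset) = ∑ v ∈ leaves τ.toFinset, f (grow τ.toFinset v) := by
  induction τ generalizing f with
  | leaf =>
    have h : leaves ({[]} : Finset (Vertex d)) = {[]} := by ext v; simp +contextual [leaves]
    simp only [succSum, Shape.toFinset, h, Finset.sum_singleton]
    congr 1
    ext v
    simp [joinTrees, grow, eq_comm]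
  | node c ih =>
    simp only [succSum, Shape.toFinset]
    rw [leaves_joinTrees hd fun i => nil_mem_toFinset _, Finset.sum_biUnion]
    · refine Finset.sum_congr rfl fun i _ => ?_
      rw [Finset.sum_image (fun a _ b _ h => List.append_cancel_right h)]
      simp only [grow_joinTrees]
      rw [← ih i fun A => f (joinTrees (Function.update (fun i => (c i).toFinset) i A))]
      refine succSum_congr _ fun σ _ => ?_
      congr 2
      funext j
      by_cases hj : j = i
      · subst hj; simp
      · simp [hj]
    · intro i _ j _ hij
      refine Finset.disjoint_left.2 fun v hv hv' => hij ?_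
      obtain ⟨a, -, rfl⟩ := Finset.mem_image.1 hv
      obtain ⟨b, -, hb⟩ := Finset.mem_image.1 hv'
      have := (List.append_inj' hb rfl).2
      simp_all

lemma card_leaves_toFinset (hd : 1 ≤ d) (τ : Shape d) :
    ((leaves τ.toFinset).card : ℝ) = numLeaves d τ.internal := by
  have := succSum_toFinset hd τ fun _ => 1
  rw [succSum_one] at this
  simp [this]

lemma mean_mono (hd : 1 ≤ d) {n : ℕ} {f g : Shape d → ℝ}
    (h : ∀ τ : Shape d, τ.internal = n → f τ ≤ g τ) : mean n f ≤ mean n g := by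
  cases n with
  | zero => exact h _ rfl
  | succ n =>
    rw [mean_succ, mean_succ]
    exact forestMean_mono hd fun c hc => h _ (by rw [Shape.internal, hc, add_comm])

/-! ### Deterministic size bounds -/

/-- A set of vertices that, at every vertex, avoids the whole subtree of some child. -/
def AvoidsChild (S : Finset (Vertex d)) : Prop :=
  ∀ v : Vertex d, ∃ i : Fin d, ∀ u ∈ S, ¬ (i :: v) <:+ u

/-- The part of `S` in the subtree hanging off `[i]`. -/
noncomputable def branch (S : Finset (Vertex d)) (i : Fin d) : Finset (Vertex d) :=
  S.preimage (· ++ [i]) fun _ _ _ _ h => List.append_cancel_right h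

lemma mem_branch {S : Finset (Vertex d)} {i : Fin d} {v : Vertex d} :
    v ∈ branch S i ↔ v ++ [i] ∈ S := Finset.mem_preimage

lemma AvoidsChild.branch {S : Finset (Vertex d)} (h : AvoidsChild S) (i : Fin d) :
    AvoidsChild (branch S i) := fun v => by
  obtain ⟨j, hj⟩ := h (v ++ [i])
  refine ⟨j, fun u hu hs => hj _ (mem_branch.1 hu) ?_⟩
  rw [← List.cons_append]
  exact List.suffix_append_self_iff.2 hs

lemma AvoidsChild.exists_branch_eq_empty {S : Finset (Vertex d)} (h : AvoidsChild S) :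
    ∃ i, RecTree.branch S i = ∅ := by
  obtain ⟨i, hi⟩ := h []
  refine ⟨i, Finset.eq_empty_of_forall_notMem fun u hu => hi _ (mem_branch.1 hu) ?_⟩
  exact List.suffix_append _ _

lemma card_le_one_add_sum_branch (S : Finset (Vertex d)) :
    S.card ≤ 1 + ∑ i, (branch S i).card := by
  have : S ⊆ joinTrees (branch S) := fun v hv => by
    rcases List.eq_nil_or_concat v with rfl | ⟨u, j, rfl⟩
    · exact nil_mem_joinTrees _
    · rw [List.concat_eq_append] at hv ⊢
      exact append_mem_joinTrees.2 (mem_branch.2 hv)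
  refine (Finset.card_le_card this).trans ((Finset.card_insert_le _ _).trans ?_)
  rw [add_comm]
  gcongr
  exact Finset.card_biUnion_le.trans (Finset.sum_le_sum fun i _ => Finset.card_image_le)

lemma branch_subset_of_subset_node {S : Finset (Vertex d)} {c : Fin d → Shape d}
    (h : S ⊆ (Shape.node c).toFinset) (i : Fin d) : branch S i ⊆ (c i).toFinset :=
  fun _ hv => append_mem_joinTrees.1 (h (mem_branch.1 hv))

/-- The extra `1` on the left closes the induction: the `d ≥ 2` units from the children pay for the
root and for the new `1`. -/
lemma card_le_of_subset_toFinset (hd : 2 ≤ d) (τ : Shape d) {S : Finset (Vertex d)}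
    (h : S ⊆ τ.toFinset) : (S.card : ℝ) + 1 ≤ 2 * numLeaves d τ.internal := by
  induction τ generalizing S with
  | leaf =>
    have : S.card ≤ 1 := Finset.card_le_card h
    have : (S.card : ℝ) ≤ 1 := by exact_mod_cast this
    simp only [Shape.internal, numLeaves_zero]
    linarith
  | node c ih =>
    have h1 : (S.card : ℝ) ≤ 1 + ∑ i, ((branch S i).card : ℝ) := by
      exact_mod_cast card_le_one_add_sum_branch S
    have h2 := Finset.sum_le_sum fun i (_ : i ∈ Finset.univ) =>
      ih i (branch_subset_of_subset_node h i)
    rw [Finset.sum_add_distrib, ← Finset.mul_sum, sum_numLeaves] at h2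
    simp only [Finset.sum_const, Finset.card_univ, Fintype.card_fin, nsmul_eq_mul, mul_one] at h2
    have : (2 : ℝ) ≤ d := by exact_mod_cast hd
    rw [Shape.internal]
    linarith

/-- The size of a set of vertices that avoids a child at every vertex, in terms of the potential. -/
lemma card_le_of_avoidsChild (hd : 2 ≤ d) {ε : ℝ} (hε0 : 0 < ε) (hε1 : ε < 1) (τ : Shape d)
    {S : Finset (Vertex d)} (h : S ⊆ τ.toFinset) (hS : AvoidsChild S) (k : ℕ) :
    (S.card : ℝ) ≤ 2 * (1 - ε) ^ k * numLeaves d τ.internal + 2 ^ k * potential ε τ := by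
  have hd1 : 1 ≤ d := by omega
  have hlam : 0 ≤ 1 - ε := by linarith
  induction τ generalizing S k with
  | leaf =>
    have : S.card ≤ 1 := Finset.card_le_card h
    have h1 : (S.card : ℝ) ≤ 1 := by exact_mod_cast this
    have h2 : (1 : ℝ) ≤ 2 ^ k := one_le_pow₀ (by norm_num)
    simp only [Shape.internal, numLeaves_zero, potential]
    have : 0 ≤ 2 * (1 - ε) ^ k := by positivity
    linarith
  | node c ih =>
    cases k with
    | zero =>
      have h1 := card_le_of_subset_toFinset hd _ h
      have h2 := potential_pos ε (Shape.node c)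
      simp only [pow_zero, mul_one, one_mul]
      linarith
    | succ k =>
      have h1 : (S.card : ℝ) ≤ 1 + ∑ i, ((branch S i).card : ℝ) := by
        exact_mod_cast card_le_one_add_sum_branch S
      have hsub := branch_subset_of_subset_node h
      have h2 : (1 : ℝ) ≤ 2 ^ (k + 1) := one_le_pow₀ (by norm_num)
      set L := numLeaves d (Shape.node c).internal with hL
      have hL0 : 0 < L := numLeaves_pos hd1 _
      have hLsum : ∑ i, numLeaves d (c i).internal = L := sum_numLeaves _
      -- A balanced root uses up one unit of `k`: the empty branch removes `ε * L` leaves, and the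
      -- weight `1 / 2` turns `2 ^ (k + 1)` into `2 ^ k`. An unbalanced root keeps the exponent and
      -- has weight `1`.
      by_cases hgood : ε * L ^ d ≤ ∏ i, numLeaves d (c i).internal
      · obtain ⟨i₀, hi₀⟩ := hS.exists_branch_eq_empty
        have hw : splitWeight ε (fun i => (c i).internal) = 1 / 2 := if_pos hgood
        have hlarge : ε * L ≤ numLeaves d (c i₀).internal := by
          have h3 := hgood.trans (prod_numLeaves_le hd1 (fun i => (c i).internal) i₀)
          have h4 : L ^ d = L * L ^ (d - 1) := by
            rw [← pow_succ', Nat.sub_add_cancel hd1]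
          rw [h4, ← mul_assoc] at h3
          exact le_of_mul_le_mul_right h3 (by positivity)
        have hsum : ∑ i, ((branch S i).card : ℝ) ≤
            2 * (1 - ε) ^ k * ((1 - ε) * L) + 2 ^ k * ∑ i, potential ε (c i) := by
          rw [← Finset.add_sum_erase _ _ (Finset.mem_univ i₀), hi₀]
          rw [← Finset.add_sum_erase _ _ (Finset.mem_univ i₀)] at hLsum
          rw [← Finset.add_sum_erase _ (fun i => potential ε (c i)) (Finset.mem_univ i₀)]
          have h5 := Finset.sum_le_sum fun i (_ : i ∈ Finset.univ.erase i₀) =>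
            ih i (hsub i) (hS.branch i) k
          rw [Finset.sum_add_distrib, ← Finset.mul_sum, ← Finset.mul_sum] at h5
          have h6 : ∑ i ∈ Finset.univ.erase i₀, numLeaves d (c i).internal ≤ (1 - ε) * L := by
            linarith
          have h7 := mul_le_mul_of_nonneg_left h6 (show 0 ≤ 2 * (1 - ε) ^ k by positivity)
          have h8 : 0 ≤ 2 ^ k * potential ε (c i₀) :=
            mul_nonneg (by positivity) (potential_pos _ _).le
          simp only [Finset.card_empty, Nat.cast_zero, mul_add]
          linarith
        rw [potential, hw]
        calc (S.card : ℝ) ≤ 1 + (2 * (1 - ε) ^ k * ((1 - ε) * L) +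
              2 ^ k * ∑ i, potential ε (c i)) := by linarith
          _ ≤ 2 ^ (k + 1) + (2 * (1 - ε) ^ k * ((1 - ε) * L) +
              2 ^ k * ∑ i, potential ε (c i)) := by linarith
          _ = _ := by ring
      · have hw : splitWeight ε (fun i => (c i).internal) = 1 := if_neg hgood
        have h5 := Finset.sum_le_sum fun i (_ : i ∈ Finset.univ) =>
            ih i (hsub i) (hS.branch i) (k + 1)
        rw [Finset.sum_add_distrib, ← Finset.mul_sum, ← Finset.mul_sum, hLsum] at h5
        rw [potential, hw]
        linarith

/-- At a vertex of `S` some child is absent, and connectedness excludes its descendants. At a vertex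
outside `S`, meeting every child's subtree would put the top `ρ` below two different children. -/
lemma IsArySubtree.avoidsChild {r : ℕ} (hrd : r < d) (hd : 2 ≤ d) {S : Finset (Vertex d)}
    (hS : IsArySubtree r S) : AvoidsChild S := by
  obtain ⟨⟨ρ, hρ, hpar⟩, hcard⟩ := hS
  -- every vertex of `S` lies below `ρ`, with all vertices in between
  have hbelow : ∀ n : ℕ, ∀ u ∈ S, u.length = n → ρ <:+ u ∧
      ∀ v, v <:+ u → ρ.length ≤ v.length → v ∈ S := by
    intro n
    induction n with
    | zero =>
      intro u hu hn
      obtain rfl := List.length_eq_zero_iff.1 hn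
      by_cases h : [] = ρ
      · subst h
        refine ⟨List.suffix_rfl, fun v hv _ => by rwa [List.suffix_nil.1 hv]⟩
      · obtain ⟨i, w, hw, -⟩ := hpar _ hu h
        simp at hw
    | succ n ih =>
      intro u hu hn
      by_cases h : u = ρ
      · subst h
        refine ⟨List.suffix_rfl, fun v hv hl => ?_⟩
        rwa [hv.eq_of_length_le hl]
      · obtain ⟨i, w, rfl, hw⟩ := hpar _ hu h
        obtain ⟨h1, h2⟩ := ih w hw (by simpa using hn)
        refine ⟨h1.trans (List.suffix_cons _ _), fun v hv hl => ?_⟩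
        rcases List.suffix_cons_iff.1 hv with rfl | hv
        · exact hu
        · exact h2 v hv hl
  intro v
  by_cases hv : v ∈ S
  · have : ∃ i : Fin d, i :: v ∉ S := by
      by_contra! hall
      have := hcard v hv
      rw [Finset.filter_true_of_mem fun i _ => hall i] at this
      simp at this
      omega
    obtain ⟨i, hi⟩ := this
    refine ⟨i, fun u hu hs => hi ?_⟩
    have hρv := (hbelow _ v hv rfl).1.length_le
    exact (hbelow _ u hu rfl).2 _ hs (by simp; omega)
  · -- two different children cannot both have descendants in `S`
    by_contra! hall
    have hlt : v.length < ρ.length := by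
      obtain ⟨u, hu, hs⟩ := hall ⟨0, by omega⟩
      by_contra! hle
      exact hv ((hbelow _ u hu rfl).2 v ((List.suffix_cons _ _).trans hs) hle)
    have hall' : ∀ i : Fin d, (i :: v) <:+ ρ := fun i => by
      obtain ⟨u, hu, hs⟩ := hall i
      exact List.suffix_of_suffix_length_le hs (hbelow _ u hu rfl).1 (by simpa using hlt)
    have h0 := hall' ⟨0, by omega⟩
    have h1 := hall' ⟨1, by omega⟩
    have := (List.suffix_of_suffix_length_le h0 h1 (by simp)).eq_of_length (by simp)
    simp at this

lemma maxArySubtree_le (hd : 2 ≤ d) {r : ℕ} (hrd : r < d) {ε : ℝ} (hε0 : 0 < ε) (hε1 : ε < 1)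
    (τ : Shape d) (k : ℕ) :
    (maxArySubtree r τ.toFinset : ℝ) ≤
      2 * (1 - ε) ^ k * numLeaves d τ.internal + 2 ^ k * potential ε τ := by
  classical
  have hpos : 0 ≤ 2 * (1 - ε) ^ k * numLeaves d τ.internal + 2 ^ k * potential ε τ := by
    have h1 := (numLeaves_pos (show 1 ≤ d by omega) τ.internal).le
    have h2 := (potential_pos ε τ).le
    have : 0 ≤ 1 - ε := by linarith
    positivity
  rw [← Nat.le_floor_iff hpos]
  refine Finset.sup_le fun S hS => ?_
  rw [Finset.mem_filter, Finset.mem_powerset] at hS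
  exact Nat.le_floor (card_le_of_avoidsChild hd hε0 hε1 τ hS.1 (hS.2.avoidsChild hrd hd) k)

lemma maxArySubtree_mono (r : ℕ) {A B : Finset (Vertex d)} (h : A ⊆ B) :
    maxArySubtree r A ≤ maxArySubtree r B := by
  classical
  refine Finset.sup_mono (Finset.filter_subset_filter _ (Finset.powerset_mono.2 h))

lemma mean_const_mul (n : ℕ) (a : ℝ) (f : Shape d → ℝ) :
    mean n (fun τ => a * f τ) = a * mean n f := by
  cases n with
  | zero => rfl
  | succ n => rw [mean_succ, mean_succ, forestMean_const_mul]

lemma grow_injOn_leaves (hd : 1 ≤ d) (A : Finset (Vertex d)) :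
    Set.InjOn (grow A) (leaves A) := by
  intro v hv w _ h
  have h0 : (⟨0, hd⟩ : Fin d) :: v ∈ grow A v := by simp [grow]
  rw [h, grow, Finset.mem_union] at h0
  rcases h0 with h0 | h0
  · exact absurd h0 ((Finset.mem_filter.1 hv).2 _)
  · obtain ⟨i, -, hi⟩ := Finset.mem_image.1 h0
    exact (List.cons.inj hi).2.symm

lemma iUnion_step_subset {Ω : Type*} {T : ℕ → Ω → Finset (Vertex d)} (t : ℕ)
    (A : Finset (Vertex d)) :
    ⋃ v ∈ leaves A, {ω | T t ω = A ∧ T (t + 1) ω = grow A v} ⊆ {ω | T t ω = A} :=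
  Set.iUnion₂_subset fun _ _ _ hω => hω.1

/-! ### The law of the process -/

namespace IsRandomRecursiveTree

variable {Ω : Type*} [MeasurableSpace Ω] {P : Measure Ω} {T : ℕ → Ω → Finset (Vertex d)}

/-- Sum the defining identity over the countably many histories that end in `A`. -/
lemma measure_step (hT : IsRandomRecursiveTree P T) (t : ℕ) (A : Finset (Vertex d))
    {v : Vertex d} (hv : v ∈ leaves A) :
    P {ω | T t ω = A ∧ T (t + 1) ω = grow A v} = P {ω | T t ω = A} / (leaves A).card := by
  let ext : (Fin (t + 1) → Finset (Vertex d)) → ℕ → Finset (Vertex d) :=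
    fun h s => if hs : s < t + 1 then h ⟨s, hs⟩ else ∅
  let I := {h : Fin (t + 1) → Finset (Vertex d) // ext h t = A}
  let E : I → Set Ω := fun h => {ω | ∀ s ≤ t, T s ω = ext h.1 s}
  have hEm : ∀ h, MeasurableSet (E h) := fun h => by
    have : E h = ⋂ s ∈ Set.Iic t, {ω | T s ω = ext h.1 s} := by ext ω; simp [E]
    rw [this]
    exact MeasurableSet.biInter (Set.to_countable _) fun s _ => hT.measurableSet_eq _ _
  have hEd : Pairwise (Function.onFun Disjoint E) := by
    intro h h' hne
    refine Set.disjoint_left.2 fun ω hω hω' => hne (Subtype.ext (funext fun s => ?_))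
    have h1 := (hω s (Nat.lt_succ_iff.1 s.2)).symm.trans (hω' s (Nat.lt_succ_iff.1 s.2))
    simpa only [ext, s.2, dite_true] using h1
  have hEU : {ω | T t ω = A} = ⋃ h, E h := by
    ext ω
    simp only [Set.mem_iUnion, Set.mem_ofPred_eq, E]
    constructor
    · intro hω
      refine ⟨⟨fun s => T s ω, by simpa [ext] using hω⟩, fun s hs => ?_⟩
      simp only [ext, Nat.lt_succ_of_le hs, dite_true]
    · rintro ⟨h, hh⟩
      rw [hh t le_rfl, h.2]
  have hF : {ω | T t ω = A ∧ T (t + 1) ω = grow A v} =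
      ⋃ h, (E h ∩ {ω | T (t + 1) ω = grow A v}) := by
    rw [← Set.iUnion_inter, ← hEU]; rfl
  rw [hF, measure_iUnion (fun h h' hne => (hEd hne).mono Set.inter_subset_left
    Set.inter_subset_left) fun h => (hEm h).inter (hT.measurableSet_eq _ _), hEU,
    measure_iUnion hEd hEm, div_eq_mul_inv, ← ENNReal.tsum_mul_right]
  refine tsum_congr fun h => ?_
  have := hT.succ t (ext h.1) v (by rw [h.2]; exact hv)
  rw [h.2, div_eq_mul_inv] at this
  exact this

/-- The growth events for distinct leaves are disjoint and already exhaust the mass of `T t = A`. -/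
lemma measure_step_notMem (hd : 1 ≤ d) [IsFiniteMeasure P] (hT : IsRandomRecursiveTree P T)
    (t : ℕ) {A : Finset (Vertex d)} (hA : (leaves A).Nonempty) :
    P ({ω | T t ω = A} \ ⋃ v ∈ leaves A, {ω | T t ω = A ∧ T (t + 1) ω = grow A v}) = 0 := by
  have hm : ∀ v, MeasurableSet {ω | T t ω = A ∧ T (t + 1) ω = grow A v} := fun v =>
    (hT.measurableSet_eq _ _).inter (hT.measurableSet_eq _ _)
  have hcard : ((leaves A).card : ENNReal) ≠ 0 := by
    exact_mod_cast hA.card_pos.ne'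
  rw [measure_sdiff (iUnion_step_subset t A)
    (Finset.measurableSet_biUnion _ fun v _ => hm v).nullMeasurableSet (measure_ne_top _ _),
    measure_biUnion_finset _ fun v _ => hm v,
    Finset.sum_congr rfl fun v hv => hT.measure_step t A hv, Finset.sum_const, nsmul_eq_mul,
    ENNReal.mul_div_cancel hcard (ENNReal.natCast_ne_top _), tsub_self]
  intro v hv w hw hne
  refine Set.disjoint_left.2 fun ω h1 h2 => hne ?_
  exact grow_injOn_leaves hd A hv hw (h1.2.symm.trans h2.2)

lemma setLIntegral_step (hd : 1 ≤ d) [IsFiniteMeasure P] (hT : IsRandomRecursiveTree P T)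
    (t : ℕ) {A : Finset (Vertex d)} (hA : (leaves A).Nonempty) (g : Finset (Vertex d) → ENNReal) :
    ∫⁻ ω in {ω | T t ω = A}, g (T (t + 1) ω) ∂P =
      (∑ v ∈ leaves A, g (grow A v)) / (leaves A).card * P {ω | T t ω = A} := by
  have hm : ∀ v, MeasurableSet {ω | T t ω = A ∧ T (t + 1) ω = grow A v} := fun v =>
    (hT.measurableSet_eq _ _).inter (hT.measurableSet_eq _ _)
  have hae : {ω | T t ω = A} =ᵐ[P]
      ⋃ v ∈ leaves A, {ω | T t ω = A ∧ T (t + 1) ω = grow A v} :=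
    ae_eq_set.2 ⟨hT.measure_step_notMem hd t hA, by
      rw [Set.sdiff_eq_empty.2 (iUnion_step_subset t A), measure_empty]⟩
  rw [setLIntegral_congr hae, lintegral_biUnion_finset _ (fun v _ => hm v), div_eq_mul_inv,
    Finset.sum_mul, Finset.sum_mul]
  · refine Finset.sum_congr rfl fun v hv => ?_
    rw [setLIntegral_congr_fun (g := fun _ => g (grow A v)) (hm v)
      fun ω hω => by simp only [hω.2], setLIntegral_const, hT.measure_step t A hv,
      div_eq_mul_inv]
    ring
  · intro v hv w hw hne
    refine Set.disjoint_left.2 fun ω h1 h2 => hne ?_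
    exact grow_injOn_leaves hd A hv hw (h1.2.symm.trans h2.2)

lemma lintegral_eq_tsum (hT : IsRandomRecursiveTree P T) (t : ℕ) (g : Ω → ENNReal) :
    ∫⁻ ω, g ω ∂P = ∑' A, ∫⁻ ω in {ω | T t ω = A}, g ω ∂P := by
  rw [← lintegral_iUnion (fun A => hT.measurableSet_eq t A), ← setLIntegral_univ]
  · congr 2
    ext ω
    simp
  · intro A B hne
    exact Set.disjoint_left.2 fun ω h1 h2 => hne (h1.symm.trans h2)

lemma leaves_toFinset_nonempty (hd : 1 ≤ d) (τ : Shape d) : (leaves τ.toFinset).Nonempty := by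
  rw [← Finset.card_pos]
  have h := card_leaves_toFinset hd τ
  have := numLeaves_pos hd τ.internal
  rw [← h] at this
  exact_mod_cast this

/-- The law of the random recursive tree is given by `mean`. -/
lemma lintegral_eq_mean (hd : 1 ≤ d) [IsProbabilityMeasure P] (hT : IsRandomRecursiveTree P T)
    (t : ℕ) (f : Finset (Vertex d) → ℝ) (hf : ∀ A, 0 ≤ f A) :
    ∫⁻ ω, ENNReal.ofReal (f (T t ω)) ∂P = ENNReal.ofReal (mean t fun τ => f τ.toFinset) := by
  induction t generalizing f with
  | zero =>
    rw [lintegral_congr_ae (g := fun _ => ENNReal.ofReal (f {[]}))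
      (hT.zero.mono fun ω hω => by simp only [hω])]
    simp [mean, Shape.toFinset]
  | succ t ih =>
    -- The transition rule says nothing about trees without leaves; they have probability zero by
    -- the induction hypothesis for an indicator, as every shape has a leaf.
    have hnull : ∀ A, ¬ (leaves A).Nonempty → P {ω | T t ω = A} = 0 := by
      classical
      intro A hA
      have h := ih (fun B => if B = A then 1 else 0) fun B => by positivity
      have h0 : mean t (fun τ : Shape d => if τ.toFinset = A then (1 : ℝ) else 0) = 0 := by
        have : (fun τ : Shape d => if τ.toFinset = A then (1 : ℝ) else 0) =
            fun _ => 0 * (0 : ℝ) := by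
          funext τ
          rw [if_neg, zero_mul]
          rintro rfl
          exact hA (leaves_toFinset_nonempty hd τ)
        rw [this, mean_const_mul, zero_mul]
      rw [h0] at h
      have h1 : ∀ ω, ENNReal.ofReal (if T t ω = A then 1 else 0) =
          Set.indicator {ω | T t ω = A} 1 ω := fun ω => by
        by_cases h : T t ω = A <;> simp [h]
      simp only [h1] at h
      rwa [lintegral_indicator_one (hT.measurableSet_eq t A), ENNReal.ofReal_zero] at h
    have hK := ih (fun A => (∑ v ∈ leaves A, f (grow A v)) / (leaves A).card) fun A =>
      div_nonneg (Finset.sum_nonneg fun v _ => hf _) (Nat.cast_nonneg _)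
    have e : (fun τ : Shape d => (∑ v ∈ leaves τ.toFinset, f (grow τ.toFinset v)) /
        ((leaves τ.toFinset).card : ℝ)) = stepMean fun τ => f τ.toFinset := by
      funext τ
      rw [card_leaves_toFinset hd, ← succSum_toFinset hd, stepMean]
    rw [e] at hK
    rw [mean, ← hK, hT.lintegral_eq_tsum t, hT.lintegral_eq_tsum t]
    refine tsum_congr fun A => ?_
    by_cases hA : (leaves A).Nonempty
    · rw [hT.setLIntegral_step hd t hA fun A => ENNReal.ofReal (f A),
        setLIntegral_congr_fun (g := fun _ => ENNReal.ofReal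
          ((∑ v ∈ leaves A, f (grow A v)) / (leaves A).card)) (hT.measurableSet_eq t A)
          fun ω hω => by simp only [show T t ω = A from hω], setLIntegral_const,
        ENNReal.ofReal_div_of_pos (by exact_mod_cast hA.card_pos),
        ENNReal.ofReal_sum_of_nonneg fun v _ => hf _, ENNReal.ofReal_natCast]
    · rw [setLIntegral_measure_zero _ _ (hnull A hA), setLIntegral_measure_zero _ _ (hnull A hA)]

lemma measure_setOf_le_mean (hd : 1 ≤ d) [IsProbabilityMeasure P]
    (hT : IsRandomRecursiveTree P T) (t : ℕ) (p : Finset (Vertex d) → Prop) {f : Shape d → ℝ}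
    (hf : ∀ τ, 0 ≤ f τ) (h : ∀ τ : Shape d, τ.internal = t → p τ.toFinset → 1 ≤ f τ) :
    P {ω | p (T t ω)} ≤ ENNReal.ofReal (mean t f) := by
  classical
  have hm : MeasurableSet {ω | p (T t ω)} := by
    have : {ω | p (T t ω)} = ⋃ A ∈ {A | p A}, {ω | T t ω = A} := by ext ω; simp
    rw [this]
    exact MeasurableSet.biUnion (Set.to_countable _) fun A _ => hT.measurableSet_eq t A
  have h1 := hT.lintegral_eq_mean hd t (fun A => if p A then 1 else 0) fun B => by positivity
  have h2 : ∀ ω, ENNReal.ofReal (if p (T t ω) then 1 else 0) =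
      Set.indicator {ω | p (T t ω)} 1 ω := fun ω => by
    by_cases h : p (T t ω) <;> simp [h]
  simp only [h2] at h1
  rw [lintegral_indicator_one hm] at h1
  rw [h1]
  refine ENNReal.ofReal_le_ofReal (mean_mono hd fun τ hτ => ?_)
  split_ifs with hp
  · exact h τ hτ hp
  · exact hf τ

lemma ae_subset_succ (hd : 1 ≤ d) [IsProbabilityMeasure P] (hT : IsRandomRecursiveTree P T)
    (t : ℕ) : ∀ᵐ ω ∂P, T t ω ⊆ T (t + 1) ω := by
  have hne : ∀ᵐ ω ∂P, (leaves (T t ω)).Nonempty := by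
    have h := hT.measure_setOf_le_mean hd t (fun A => ¬ (leaves A).Nonempty)
      (f := fun _ => 0 * (0 : ℝ)) (fun _ => by simp)
      fun τ _ h => absurd (leaves_toFinset_nonempty hd τ) h
    rw [mean_const_mul, zero_mul, ENNReal.ofReal_zero] at h
    exact le_antisymm h zero_le
  have hstep : ∀ᵐ ω ∂P, ∀ A, (leaves A).Nonempty → ω ∉ {ω | T t ω = A} \
      ⋃ v ∈ leaves A, {ω | T t ω = A ∧ T (t + 1) ω = grow A v} := by
    refine ae_all_iff.2 fun A => ?_
    by_cases hA : (leaves A).Nonempty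
    · simpa only [hA, true_implies] using
        measure_eq_zero_iff_ae_notMem.1 (hT.measure_step_notMem hd t hA)
    · exact Eventually.of_forall fun ω h => absurd h hA
  filter_upwards [hne, hstep] with ω h1 h2
  have h3 := h2 _ h1
  simp only [Set.mem_sdiff, Set.mem_ofPred_eq, true_and, not_not, Set.mem_iUnion] at h3
  obtain ⟨v, -, hv⟩ := h3
  rw [hv]
  exact Finset.subset_union_left

lemma ae_monotone (hd : 1 ≤ d) [IsProbabilityMeasure P] (hT : IsRandomRecursiveTree P T) :
    ∀ᵐ ω ∂P, Monotone fun t => T t ω :=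
  (ae_all_iff.2 fun t => hT.ae_subset_succ hd t).mono fun _ h => monotone_nat_of_le_succ h

/-- A tail bound for the size of a largest `r`-ary subtree. -/
lemma measure_maxArySubtree_le (hd : 2 ≤ d) [IsProbabilityMeasure P]
    (hT : IsRandomRecursiveTree P T) {r : ℕ} (hrd : r < d) {ε : ℝ} (hε0 : 0 < ε) (hε1 : ε < 1)
    (t k : ℕ) {a : ℝ} (ha : 0 < a) :
    P {ω | 2 * (1 - ε) ^ k * numLeaves d t + 2 ^ k * a ≤ maxArySubtree r (T t ω)} ≤
      ENNReal.ofReal (mean t (potential (d := d) ε) / a) := by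
  rw [div_eq_inv_mul, ← mean_const_mul]
  refine hT.measure_setOf_le_mean (by omega) t (fun A => 2 * (1 - ε) ^ k * numLeaves d t +
    2 ^ k * a ≤ maxArySubtree r A) (fun τ => ?_) fun τ hτ h => ?_
  · exact mul_nonneg (by positivity) (potential_pos _ _).le
  · have h1 := h.trans (maxArySubtree_le hd hrd hε0 hε1 τ k)
    -- The leaf terms cancel, so the event forces the potential to be at least `a`: this is Markov's
    -- inequality.
    rw [hτ, add_le_add_iff_left] at h1
    rw [← div_eq_inv_mul, one_le_div ha]
    exact le_of_mul_le_mul_left h1 (by positivity)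

end IsRandomRecursiveTree

/-! ### Borel–Cantelli along `B ^ k` and interpolation -/

lemma numLeaves_le_mul {n : ℕ} (hn : 1 ≤ n) : numLeaves d n ≤ d * n := by
  have : (1 : ℝ) ≤ n := by exact_mod_cast hn
  unfold numLeaves
  linarith

/-- A geometric bound along the times `B ^ k`, with constants that depend on `d` only. -/
lemma exists_forall_maxArySubtree_lt (hd : 2 ≤ d) :
    ∃ B : ℕ, 3 ≤ B ∧ ∃ ρ : ℝ, 1 / 2 ≤ ρ ∧ ρ < 1 ∧ ∀ (r : ℕ), r < d →
      ∀ {Ω : Type*} [MeasurableSpace Ω] (P : Measure Ω) [IsProbabilityMeasure P]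
        (T : ℕ → Ω → Finset (Vertex d)), IsRandomRecursiveTree P T →
        ∀ᵐ ω ∂P, ∀ᶠ k : ℕ in atTop,
          (maxArySubtree r (T (B ^ k) ω) : ℝ) < (2 * d + 1) * (ρ * B) ^ k := by
  have hd1 : 1 ≤ d := by omega
  obtain ⟨ε, hε0, hε1, β, hβ0, hβ1, C, hC0, hmean⟩ := exists_mean_potential_le hd1
  -- At time `B ^ k` the mean potential is of order `(B ^ β) ^ k`. Against the threshold `(B / 4) ^
  -- k` the ratio is `(4 * B ^ (β - 1)) ^ k`, which is then summable; and `2 ^ k` times the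
  -- threshold is only `(B / 2) ^ k`.
  obtain ⟨B, hB3, hB⟩ : ∃ B : ℕ, 3 ≤ B ∧ 4 * (B : ℝ) ^ (β - 1) ≤ 1 / 2 := by
    have h1 : Tendsto (fun B : ℕ => (B : ℝ) ^ (-(1 - β))) atTop (nhds 0) :=
      (tendsto_rpow_neg_atTop (by linarith)).comp tendsto_natCast_atTop_atTop
    obtain ⟨B, h2, h3⟩ := ((h1.eventually (gt_mem_nhds (show (0 : ℝ) < 1 / 8 by norm_num))).and
      (eventually_ge_atTop 3)).exists
    refine ⟨B, h3, ?_⟩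
    rw [neg_sub] at h2
    linarith
  have hB0 : (0 : ℝ) < B := by exact_mod_cast (show 0 < B by omega)
  refine ⟨B, hB3, max (1 - ε) (1 / 2), le_max_right _ _, max_lt (by linarith) (by norm_num),
    fun r hrd Ω _ P _ T hT => ?_⟩
  set ρ := max (1 - ε) (1 / 2) with hρ
  set D := C * (d : ℝ) ^ β with hD
  have hD0 : 0 ≤ D := by positivity
  have htail : ∀ k : ℕ, P {ω | 2 * (1 - ε) ^ k * numLeaves d (B ^ k) + 2 ^ k * (B / 4 : ℝ) ^ k ≤
      maxArySubtree r (T (B ^ k) ω)} ≤ ENNReal.ofReal (D * (1 / 2) ^ k) := by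
    intro k
    refine (hT.measure_maxArySubtree_le hd hrd hε0 hε1 (B ^ k) k (by positivity)).trans
      (ENNReal.ofReal_le_ofReal ?_)
    rw [div_le_iff₀ (by positivity)]
    have hL := numLeaves_le_mul (d := d) (Nat.one_le_pow k B (by omega))
    calc mean (B ^ k) (potential (d := d) ε) ≤ C * numLeaves d (B ^ k) ^ β := hmean _
      _ ≤ C * (d * (B ^ k : ℕ)) ^ β := by
          gcongr
          exact (numLeaves_pos hd1 _).le
      _ = D * ((4 * (B : ℝ) ^ (β - 1)) * (B / 4)) ^ k := by
          rw [Real.mul_rpow (by positivity) (by positivity), hD, mul_assoc, Nat.cast_pow,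
            ← Real.rpow_natCast_mul hB0.le, mul_comm (k : ℝ), Real.rpow_mul_natCast hB0.le,
            show 4 * (B : ℝ) ^ (β - 1) * (B / 4) = (B : ℝ) ^ (β - 1) * B by ring,
            ← Real.rpow_add_one hB0.ne', sub_add_cancel]
      _ ≤ D * (1 / 2 * (B / 4)) ^ k := by gcongr
      _ = D * (1 / 2) ^ k * (B / 4 : ℝ) ^ k := by rw [mul_pow]; ring
  have hsum : ∑' k : ℕ, P {ω | 2 * (1 - ε) ^ k * numLeaves d (B ^ k) +
      2 ^ k * (B / 4 : ℝ) ^ k ≤ maxArySubtree r (T (B ^ k) ω)} ≠ ⊤ := by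
    refine ne_top_of_le_ne_top ?_ (ENNReal.tsum_le_tsum htail)
    exact (summable_geometric_two.mul_left D).tsum_ofReal_ne_top
  filter_upwards [ae_eventually_notMem hsum] with ω hω
  filter_upwards [hω] with k hk
  have hk' := not_le.1 hk
  refine hk'.trans_le ?_
  have hL := numLeaves_le_mul (d := d) (Nat.one_le_pow k B (by omega))
  rw [Nat.cast_pow] at hL
  have h1 : (1 - ε) ^ k ≤ ρ ^ k := pow_le_pow_left₀ (by linarith) (le_max_left _ _) k
  have h2 : (1 / 2 : ℝ) ^ k ≤ ρ ^ k := pow_le_pow_left₀ (by norm_num) (le_max_right _ _) k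
  have hε' : 0 ≤ (1 - ε) ^ k := pow_nonneg (by linarith) k
  calc 2 * (1 - ε) ^ k * numLeaves d (B ^ k) + 2 ^ k * (B / 4 : ℝ) ^ k
      ≤ 2 * ρ ^ k * (d * (B : ℝ) ^ k) + (1 / 2) ^ k * (B : ℝ) ^ k := by
        refine add_le_add ?_ (le_of_eq ?_)
        · exact mul_le_mul (by linarith) hL (numLeaves_pos hd1 _).le (by linarith)
        · rw [← mul_pow, ← mul_pow]; congr 1; ring
    _ ≤ 2 * ρ ^ k * (d * (B : ℝ) ^ k) + ρ ^ k * (B : ℝ) ^ k := by gcongr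
    _ = (2 * d + 1) * (ρ * B) ^ k := by rw [mul_pow]; ring

/-- A monotone sequence that is at most a multiple of `(ρ * B) ^ k` at the times `B ^ k`, with
`ρ < 1`, grows slower than a power with exponent less than `1`. -/
lemma eventually_lt_rpow_of_geometric {B : ℕ} (hB : 3 ≤ B) {ρ : ℝ} (hρ : 1 / 2 ≤ ρ) {D δ : ℝ}
    (hδ : Real.logb B (ρ * B) < δ) {S : ℕ → ℕ} (hS : Monotone S)
    (h : ∀ᶠ k : ℕ in atTop, (S (B ^ k) : ℝ) < D * (ρ * B) ^ k) :
    ∀ᶠ t : ℕ in atTop, (S t : ℝ) < (t : ℝ) ^ δ := by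
  set γ := Real.logb B (ρ * B) with hγ
  have hB3 : (3 : ℝ) ≤ B := by exact_mod_cast hB
  have hρB : 1 ≤ ρ * B := by nlinarith
  have hγ0 : 0 ≤ γ := Real.logb_nonneg (by linarith) hρB
  have hpow : (B : ℝ) ^ γ = ρ * B :=
    Real.rpow_logb (by linarith) (by linarith) (by linarith)
  obtain ⟨K, hK⟩ := eventually_atTop.1 h
  have hlim : Tendsto (fun t : ℕ => (t : ℝ) ^ (δ - γ)) atTop atTop :=
    (tendsto_rpow_atTop (by linarith)).comp tendsto_natCast_atTop_atTop
  -- Rounding `t` up to the next power of `B` costs the constant `D * (ρ * B)`, which `t ^ (δ - γ)`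
  -- absorbs.
  filter_upwards [hlim.eventually_ge_atTop (D * (ρ * B)), eventually_ge_atTop (B ^ K)] with t h1 h2
  have ht0 : 0 < t := (Nat.pow_pos (by omega)).trans_le h2
  have ht : (0 : ℝ) < t := by exact_mod_cast ht0
  set k := Nat.log B t with hk
  have hk1 : t ≤ B ^ (k + 1) := (Nat.lt_pow_succ_log_self (by omega) t).le
  have hk2 : B ^ k ≤ t := Nat.pow_log_le_self B ht0.ne'
  have hKk : K ≤ k := Nat.le_log_of_pow_le (by omega) h2
  have hk3 : (ρ * B) ^ k ≤ (t : ℝ) ^ γ := by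
    rw [← hpow, ← Real.rpow_mul_natCast (by linarith), mul_comm, Real.rpow_natCast_mul (by linarith)]
    exact Real.rpow_le_rpow (by positivity) (by exact_mod_cast hk2) hγ0
  calc (S t : ℝ) ≤ S (B ^ (k + 1)) := by exact_mod_cast hS hk1
    _ < D * (ρ * B) ^ (k + 1) := hK _ (by omega)
    _ = D * (ρ * B) * (ρ * B) ^ k := by ring
    _ ≤ (t : ℝ) ^ (δ - γ) * (t : ℝ) ^ γ := by gcongr
    _ = (t : ℝ) ^ δ := by rw [← Real.rpow_add ht, sub_add_cancel]

end RecTree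

theorem theorem1 (r d : ℕ) (hr : 1 ≤ r) (hrd : r < d) :
    ∃ δ : ℝ, δ < 1 ∧
      ∀ {Ω : Type*} [MeasurableSpace Ω] (P : Measure Ω) [IsProbabilityMeasure P]
        (T : ℕ → Ω → Finset (RecTree.Vertex d)), RecTree.IsRandomRecursiveTree P T →
        ∀ᵐ ω ∂P, ∀ᶠ t : ℕ in atTop,
          (RecTree.maxArySubtree r (T t ω) : ℝ) < (t : ℝ) ^ δ := by
  obtain ⟨B, hB, ρ, hρ, hρ1, hmain⟩ :=
    RecTree.exists_forall_maxArySubtree_lt (show 2 ≤ d by omega)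
  have hB3 : (3 : ℝ) ≤ B := by exact_mod_cast hB
  have hγ : Real.logb B (ρ * B) < 1 := by
    rw [Real.logb_lt_iff_lt_rpow (by linarith) (by nlinarith), Real.rpow_one]
    nlinarith
  obtain ⟨δ, hδ, hδ1⟩ := exists_between hγ
  refine ⟨δ, hδ1, fun {Ω} _ P _ T hT => ?_⟩
  filter_upwards [hmain r hrd P T hT, hT.ae_monotone (by omega)] with ω h hmono
  exact RecTree.eventually_lt_rpow_of_geometric hB hρ hδ
    (fun s t hst => RecTree.maxArySubtree_mono r (hmono hst)) h
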